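/- Let \(d\ge 2\) be an integer, let \(\gamma\ge d\) be real, and let \(0<T<\infty\), \(r_0>0\). Let \(\mu_d\) be the isometry-invariant measure on the space of un-sensed lines of \(\mathbb{R}^d\), normalized so that for every convex body \(K\) the set of lines hitting \(K\) has measure \(\tfrac12 m_{d-1}(\partial K)\); equivalently \(\mu_d(d\ell)=\kappa_{d-1}^{-1}\,m_{d-1}(dy)\,m_{S_+^{d-1}}(d\varpi)\), where \(\varpi\) is the un-sensed direction of \(\ell\), \(y\) is its intersection with the hyperplane through the origin perpendicular to \(\ell\), and \(\kappa_{d-1}\) is the volume of the unit ball of \(\mathbb{R}^{d-1}\). Let \(\Pi\) be a Poisson process of marked lines \((\ell,v)\), with \(v>0\) the speed-limit of \(\ell\), with intensity measure \((\gamma-1)v^{-\gamma}\,dv\,\mu_d(d\ell)\). For \(v>0\) let \(\mathcal{S}_v\) be the union of all lines \(\ell\) with \((\ell,w)\in\Pi\) for some \(w\ge v\). A \(\Pi\)-path with terminal time \(\tau\in(0,\infty]\) is a locally Lipschitz function \(\xi:[0,\tau)\to\mathbb{R}^d\) such that for every \(v>0\) the set \(\{t\in[0,\tau):|\xi'(t)|>v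 \text{ and } \xi(t)\notin\mathcal{S}_v\}\) is Lebesgue-null. Then there is a finite random constant \(C=C(d,\gamma,T,r_0,\Pi)\), a measurable function of the realization of \(\Pi\) that does not depend on the path, such that almost surely every \(\Pi\)-path \(\xi\) (of any terminal time \(\tau\in(0,\infty]\)) with \(|\xi(0)|\le r_0\) satisfies \(|\xi(t)|\le C\) for all \(t\in[0,\tau)\) with \(t<T\). -/

import Mathlib

open MeasureTheory ProbabilityTheory Set Module
open scoped ENNReal NNReal

noncomputable section

namespace SpeedLimits

/-- `d`-dimensional Euclidean space. -/
abbrev E (d : ℕ) : Type := EuclideanSpace ℝ (Fin d)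

/-! ### Line-space and its invariant measure -/

/-- Line-space: un-sensed lines in `d`-dimensional Euclidean space. -/
def Line (d : ℕ) : Type := {ℓ : AffineSubspace ℝ (E d) // finrank ℝ ℓ.direction = 1}

/-- The set of points of a line. -/
def Line.carrier {d : ℕ} (ℓ : Line d) : Set (E d) := (ℓ.1 : Set (E d))

/-- The hitting set of `K`: all lines that meet `K`. -/
def hittingSet {d : ℕ} (K : Set (E d)) : Set (Line d) := {ℓ | (ℓ.carrier ∩ K).Nonempty}

/-- The Borel (hit-or-miss) sigma-algebra on line-space, generated by the hitting sets of compact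
sets. -/
instance Line.instMeasurableSpace (d : ℕ) : MeasurableSpace (Line d) :=
  MeasurableSpace.generateFrom {H | ∃ K : Set (E d), IsCompact K ∧ H = hittingSet K}

/-- The unit sphere in `d`-dimensional Euclidean space. -/
abbrev UnitSphere (d : ℕ) : Type := Metric.sphere (0 : E d) 1

/-- The line through the point `y` with direction `u`. -/
def lineThrough {d : ℕ} (u : UnitSphere d) (y : E d) : Line d :=
  ⟨AffineSubspace.mk' y (ℝ ∙ (u : E d)), by
    rw [AffineSubspace.direction_mk']
    exact finrank_span_singleton (ne_zero_of_mem_unit_sphere u)⟩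

/-- The hyperplane through the origin perpendicular to the direction `u`. -/
def perp {d : ℕ} (u : UnitSphere d) : Set (E d) := {y | inner ℝ (u : E d) y = 0}

/-- `κ_s`, the volume of the unit ball of `s`-dimensional Euclidean space. -/
def unitBallVolume (s : ℕ) : ℝ≥0∞ := volume (Metric.ball (0 : E s) 1)

/-- The lines with direction `u`, weighted by the `(d-1)`-dimensional volume of their intersection
points with the hyperplane perpendicular to `u`. -/
def parallelLineMeasure {d : ℕ} (u : UnitSphere d) : Measure (Line d) :=
  (μHE[d - 1].restrict (perp u)).map (lineThrough u)

/-- Invariant line measure `μ_d`: a line is described by its un-sensed direction and by its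
intersection with the perpendicular hyperplane, and `μ_d` is
`κ_{d-1}⁻¹ m_{d-1}(dy) m_{S₊}(dϖ)`, with `m_{S₊}` the surface measure on un-sensed directions.
Integrating over un-sensed directions is integrating over the whole unit sphere with weight `1/2`.
The constant makes `μ_d` of the hitting set of a convex body half the surface area of the body. -/
def lineMeasure (d : ℕ) : Measure (Line d) :=
  (2 * unitBallVolume (d - 1))⁻¹ •
    ((volume : Measure (E d)).toSphere).bind (fun u => parallelLineMeasure u)

/-! Proved facts: the measures above involve no junk values, and `lineMeasure` is given by the
expected integral. -/

theorem mem_lineThrough {d : ℕ} (u : UnitSphere d) (x z : E d) :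
    z ∈ (lineThrough u x).carrier ↔ ∃ s : ℝ, z = x + s • (u : E d) := by
  simp only [Line.carrier, lineThrough, SetLike.mem_coe, AffineSubspace.mem_mk',
    Submodule.mem_span_singleton, vsub_eq_sub]
  constructor
  · rintro ⟨s, hs⟩
    exact ⟨s, by rw [hs]; abel⟩
  · rintro ⟨s, rfl⟩
    exact ⟨s, by abel⟩

theorem measurable_lineThrough_uncurry (d : ℕ) :
    Measurable (fun p : UnitSphere d × E d => lineThrough p.1 p.2) := by
  refine measurable_generateFrom ?_
  rintro _ ⟨K, hK, rfl⟩
  -- the preimage is closed: it is the projection along a compact set of a closed set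
  let F : K → UnitSphere d × E d → E d := fun k p =>
    ((k : E d) - p.2) - inner ℝ (p.1 : E d) ((k : E d) - p.2) • (p.1 : E d)
  have hF : Continuous (fun q : K × (UnitSphere d × E d) => F q.1 q.2) := by
    dsimp only [F]; fun_prop
  have hcl : IsClosed {q : K × (UnitSphere d × E d) | F q.1 q.2 = 0} :=
    isClosed_eq hF continuous_const
  have : CompactSpace K := isCompact_iff_compactSpace.mp hK
  have himg := isClosedMap_snd_of_compactSpace (X := K) (Y := UnitSphere d × E d) _ hcl
  convert himg.measurableSet using 1
  ext ⟨u, x⟩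
  simp only [hittingSet, mem_preimage, mem_ofPred_eq, mem_image, Prod.exists]
  constructor
  · rintro ⟨z, hz, hzK⟩
    obtain ⟨s, rfl⟩ := (mem_lineThrough u x z).1 hz
    refine ⟨⟨_, hzK⟩, u, x, ?_, rfl⟩
    have hu : ‖(u : E d)‖ = 1 := norm_eq_of_mem_sphere u
    simp [F, inner_smul_right, hu]
  · rintro ⟨k, u', x', hk, h⟩
    obtain ⟨rfl, rfl⟩ := Prod.mk.inj h
    refine ⟨k, (mem_lineThrough _ _ _).2
      ⟨inner ℝ (u' : E d) ((k : E d) - x'), ?_⟩, k.2⟩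
    dsimp only [F] at hk
    rw [← sub_eq_zero.1 hk]
    abel

theorem measurable_lineThrough {d : ℕ} (u : UnitSphere d) : Measurable (lineThrough u) := by
  intro A hA
  exact measurable_prodMk_left (x := u) (measurable_lineThrough_uncurry d hA)

theorem lineThrough_add_smul {d : ℕ} (u : UnitSphere d) (x : E d) (s : ℝ) :
    lineThrough u (x + s • (u : E d)) = lineThrough u x := by
  apply Subtype.ext
  apply SetLike.coe_injective
  ext z
  change z ∈ (lineThrough u (x + s • (u : E d))).carrier ↔ z ∈ (lineThrough u x).carrier
  rw [mem_lineThrough, mem_lineThrough]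
  constructor
  · rintro ⟨r, rfl⟩
    exact ⟨s + r, by rw [add_smul, add_assoc]⟩
  · rintro ⟨r, rfl⟩
    exact ⟨r - s, by rw [sub_smul]; abel⟩

theorem measurableSet_perp {d : ℕ} (u : UnitSphere d) : MeasurableSet (perp u) :=
  (isClosed_eq (by fun_prop) continuous_const).measurableSet

theorem parallelLineMeasure_apply {d : ℕ} (u : UnitSphere d) {A : Set (Line d)}
    (hA : MeasurableSet A) :
    parallelLineMeasure u A = μHE[d - 1] {y : E d | inner ℝ (u : E d) y = 0 ∧ lineThrough u y ∈ A} := by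
  rw [parallelLineMeasure, Measure.map_apply (measurable_lineThrough u) hA,
    Measure.restrict_apply (measurable_lineThrough u hA)]
  congr 1
  ext y
  simp [perp, and_comm]

/-- By Fubini, the perpendicular hyperplane can be replaced by a slab of unit thickness. -/
theorem parallelLineMeasure_eq_slab {d : ℕ} (u : UnitSphere d) {A : Set (Line d)}
    (hA : MeasurableSet A) :
    parallelLineMeasure u A =
      volume {x : E d | inner ℝ (u : E d) x ∈ Ico (0 : ℝ) 1 ∧ lineThrough u x ∈ A} := by
  have hu : ‖(u : E d)‖ = 1 := norm_eq_of_mem_sphere u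
  have hu0 : (u : E d) ≠ 0 := ne_zero_of_mem_unit_sphere u
  set t : Set (E d) := {x : E d | inner ℝ (u : E d) x ∈ Ico (0 : ℝ) 1 ∧ lineThrough u x ∈ A} with ht
  have htm : MeasurableSet t := by
    refine MeasurableSet.inter ?_ (measurable_lineThrough u hA)
    exact measurableSet_Ico.preimage (by fun_prop)
  have hcut : ∀ s : ℝ, μHE[d - 1] (t ∩ AffineSubspace.mk' (s • (u : E d) +ᵥ (0 : E d))
      (ℝ ∙ (u : E d))ᗮ) = (Ico (0 : ℝ) 1).indicator (fun _ => parallelLineMeasure u A) s := by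
    intro s
    have hset : (t ∩ AffineSubspace.mk' (s • (u : E d) +ᵥ (0 : E d)) (ℝ ∙ (u : E d))ᗮ : Set (E d)) =
        {x | inner ℝ (u : E d) x = s ∧ s ∈ Ico (0 : ℝ) 1 ∧ lineThrough u x ∈ A} := by
      ext x
      simp only [ht, mem_inter_iff, mem_ofPred_eq, SetLike.mem_coe, AffineSubspace.mem_mk',
        Submodule.mem_orthogonal_singleton_iff_inner_right, vsub_eq_sub, vadd_eq_add, add_zero,
        inner_sub_right, inner_smul_right, real_inner_self_eq_norm_sq, hu, sub_eq_zero]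
      constructor
      · rintro ⟨⟨h1, h2⟩, h3⟩
        have h4 : inner ℝ (u : E d) x = s := by simpa using h3
        exact ⟨h4, h4 ▸ h1, h2⟩
      · rintro ⟨rfl, h1, h2⟩
        exact ⟨⟨h1, h2⟩, by simp⟩
    rw [hset]
    by_cases hs : s ∈ Ico (0 : ℝ) 1
    · rw [indicator_of_mem hs, parallelLineMeasure_apply u hA]
      have hiso : Isometry (fun y : E d => y + s • (u : E d)) :=
        (IsometryEquiv.addRight (s • (u : E d))).isometry
      rw [← hiso.euclideanHausdorffMeasure_image
        {y : E d | inner ℝ (u : E d) y = 0 ∧ lineThrough u y ∈ A}]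
      congr 1
      ext x
      simp only [mem_image, mem_ofPred_eq]
      constructor
      · rintro ⟨h1, -, h2⟩
        refine ⟨x - s • (u : E d), ⟨?_, ?_⟩, by abel⟩
        · simp [inner_sub_right, inner_smul_right, hu, h1]
        · have := lineThrough_add_smul u (x - s • (u : E d)) s
          rw [sub_add_cancel] at this
          rwa [← this]
      · rintro ⟨y, ⟨h1, h2⟩, rfl⟩
        refine ⟨by simp [inner_add_right, inner_smul_right, hu, h1], hs, ?_⟩
        rwa [lineThrough_add_smul]
    · rw [indicator_of_notMem hs]
      simp [hs]
  have hfub := EuclideanGeometry.euclideanHausdorffMeasure_eq_lintegral (0 : E d) hu0 htm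
  rw [InnerProductSpace.euclideanHausdorffMeasure_eq_volume, finrank_euclideanSpace_fin] at hfub
  rw [hfub]
  simp_rw [hcut]
  rw [lintegral_indicator measurableSet_Ico]
  simp [← ofReal_norm, hu]

theorem measurable_parallelLineMeasure (d : ℕ) :
    Measurable (fun u : UnitSphere d => parallelLineMeasure u) := by
  refine Measure.measurable_of_measurable_coe _ fun A hA => ?_
  simp_rw [parallelLineMeasure_eq_slab _ hA]
  have hm : MeasurableSet {p : UnitSphere d × E d |
      inner ℝ (p.1 : E d) p.2 ∈ Ico (0 : ℝ) 1 ∧ lineThrough p.1 p.2 ∈ A} := by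
    refine MeasurableSet.inter ?_ (measurable_lineThrough_uncurry d hA)
    exact measurableSet_Ico.preimage
      (by fun_prop : Continuous fun p : UnitSphere d × E d => inner ℝ (p.1 : E d) p.2).measurable
  exact measurable_measure_prodMk_left hm

/-- The disintegration formula that defines `μ_d`, spelled out. -/
theorem lineMeasure_apply {d : ℕ} {A : Set (Line d)} (hA : MeasurableSet A) :
    lineMeasure d A = (2 * unitBallVolume (d - 1))⁻¹ *
      ∫⁻ u, μHE[d - 1] {y : E d | inner ℝ (u : E d) y = 0 ∧ lineThrough u y ∈ A}
        ∂(volume : Measure (E d)).toSphere := by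
  rw [lineMeasure, Measure.smul_apply, smul_eq_mul,
    Measure.bind_apply hA (measurable_parallelLineMeasure d).aemeasurable]
  simp_rw [parallelLineMeasure_apply _ hA]

/-! ### Poisson point processes -/

/-- The sigma-algebra on point configurations in `X` generated by the counts of points in
measurable sets. -/
@[reducible] def configurationSigma (X : Type*) [MeasurableSpace X] : MeasurableSpace (Set X) :=
  ⨆ (A : Set X) (_ : MeasurableSet A), MeasurableSpace.comap (fun π : Set X => (π ∩ A).encard) ⊤

/-- `Φ` is a Poisson point process on `X` with intensity measure `ν` (without multiple points):
counts of points in measurable sets are Poisson distributed with mean given by `ν` (almost surely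
infinite if the mean is infinite), and counts in disjoint sets are independent. -/
structure IsPoissonProcess {Ω X : Type*} [MeasurableSpace Ω] [MeasurableSpace X]
    (P : Measure Ω) (Φ : Ω → Set X) (ν : Measure X) : Prop where
  measurable : Measurable[_, configurationSigma X] Φ
  law : ∀ A : Set X, MeasurableSet A → ν A ≠ ∞ →
    P.map (fun ω => (Φ ω ∩ A).encard) =
      (poissonMeasure (ν A).toNNReal).map (fun n : ℕ => (n : ℕ∞))
  infinite : ∀ A : Set X, MeasurableSet A → ν A = ∞ → ∀ᵐ ω ∂P, (Φ ω ∩ A).encard = ⊤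
  indep : ∀ (n : ℕ) (A : Fin n → Set X), (∀ i, MeasurableSet (A i)) →
    Pairwise (fun i j => Disjoint (A i) (A j)) →
    iIndepFun (fun (i : Fin n) (ω : Ω) => (Φ ω ∩ A i).encard) P

/-- The measure `(γ - 1) v^(-γ) dv` on speeds `v > 0`. -/
def speedMeasure (γ : ℝ) : Measure ℝ :=
  (volume.restrict (Ioi 0)).withDensity (fun v => ENNReal.ofReal ((γ - 1) * v ^ (-γ)))

/-- The intensity measure `(γ - 1) v^(-γ) dv μ_d(dℓ)` of the improper Poisson line process marked
with speed-limits. -/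
def markedLineIntensity (d : ℕ) (γ : ℝ) : Measure (Line d × ℝ) :=
  (lineMeasure d).prod (speedMeasure γ)

/-! ### Paths that obey the speed-limits -/

/-- The silhouette `S_v`: the union of all lines whose speed-limit is at least `v`. -/
def silhouette {d : ℕ} (π : Set (Line d × ℝ)) (v : ℝ) : Set (E d) :=
  {x | ∃ (ℓ : Line d) (w : ℝ), (ℓ, w) ∈ π ∧ v ≤ w ∧ x ∈ ℓ.carrier}

/-- The time interval `[0, τ)`, for a possibly infinite terminal time `τ`. -/
def timeInterval (τ : EReal) : Set ℝ := {t | 0 ≤ t ∧ (t : EReal) < τ}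

/-- `ξ`, restricted to `[0, τ)`, is a `Π`-path with terminal time `τ`, for the realization `π` of
the marked line process: it is locally Lipschitz and, for each `v > 0`, it is almost never faster
than `v` off the silhouette `S_v`. Values of `ξ` outside of `[0, τ)` are irrelevant. -/
structure IsPiPath {d : ℕ} (π : Set (Line d × ℝ)) (τ : EReal) (ξ : ℝ → E d) : Prop where
  terminal_pos : 0 < τ
  locallyLipschitz : LocallyLipschitzOn (timeInterval τ) ξ
  speed_limit : ∀ v : ℝ, 0 < v →
    volume {t : ℝ | t ∈ timeInterval τ ∧ v < ‖deriv ξ t‖ ∧ ξ t ∉ silhouette π v} = 0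

end SpeedLimits

end

open scoped Pointwise

/-! ### Deterministic delay: crossing times of dyadic shells -/

namespace SpeedLimits

/-! The argument is scale-invariant. Lines meeting the ball of radius `R` have measure of order `R ^
(d - 1)`, and speeds at least `K * R` have measure `(K * R) ^ (1 - γ)`. As `γ ≥ d`, for `R, K ≥ 1`
the expected number of such fast lines is at most `c / K`, uniformly in `R`
(`markedLineIntensity_fastLines_le`).

Call a dyadic scale slow if its ball is hit by no such line. A path needs time at least `1 / (2 *
K)` to cross the shell of a slow scale, so `N` slow scales cost time `N / (2 * K)`
(`IsPiPath.card_le`).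

Each scale fails to be slow with probability at most `c / K`, hence so do all large scales at once;
this needs no independence. Letting `K` grow, almost surely some `K` has infinitely many slow scales
(`ae_exists_frequently_isSlowScale`). Finitely many of them beyond `r₀` hold every path back until
time `T`, and the least dyadic radius enclosing such a barrier gives `C`. -/

theorem timeInterval_subset_of_le {τ : EReal} {a b : ℝ} (ha : 0 ≤ a) (hb : (b : EReal) < τ) :
    Icc a b ⊆ timeInterval τ := fun _ hs =>
  ⟨ha.trans hs.1, lt_of_le_of_lt (EReal.coe_le_coe_iff.2 hs.2) hb⟩

/-- A Lipschitz function on an interval, almost never faster than `V`, moves by at most `V` times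
the length of the interval. -/
theorem norm_sub_le_of_ae_norm_deriv_le {F : Type*} [NormedAddCommGroup F] [InnerProductSpace ℝ F]
    [FiniteDimensional ℝ F] {ξ : ℝ → F} {a b V : ℝ} {K : ℝ≥0} (hab : a ≤ b)
    (hξ : LipschitzOnWith K ξ (Icc a b)) (hV : ∀ᵐ t, t ∈ Icc a b → ‖deriv ξ t‖ ≤ V) :
    ‖ξ b - ξ a‖ ≤ V * (b - a) := by
  rcases eq_or_ne (ξ b - ξ a) 0 with h0 | h0
  -- The sign of `V` is not assumed: when `a < b`, it bounds a norm at some time, so `V ≥ 0`.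
  · rcases hab.eq_or_lt with rfl | hlt
    · simp
    rw [h0, norm_zero]
    have hne : (ae (volume.restrict (Icc a b))).NeBot := by
      rw [ae_neBot, Ne, Measure.restrict_eq_zero, Real.volume_Icc]
      simpa using hlt
    obtain ⟨t, ht⟩ := ((ae_restrict_iff' measurableSet_Icc).2 hV).exists
    exact mul_nonneg ((norm_nonneg _).trans ht) (sub_nonneg.2 hab)
  -- Projecting onto the direction of displacement reduces the claim to the fundamental theorem of
  -- calculus for a real absolutely continuous function.
  set u : F := ‖ξ b - ξ a‖⁻¹ • (ξ b - ξ a) with hu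
  have hu1 : ‖u‖ = 1 := by rw [hu]; exact norm_smul_inv_norm (𝕜 := ℝ) h0
  set f : ℝ → ℝ := fun t => innerSL ℝ u (ξ t) with hf
  have hfl : LipschitzOnWith (‖innerSL ℝ u‖₊ * K) f (uIcc a b) := by
    rw [uIcc_of_le hab]
    exact (innerSL ℝ u).lipschitz.comp_lipschitzOnWith hξ
  have hint := hfl.absolutelyContinuousOnInterval.integral_deriv_eq_sub
  have hfab : f b - f a = ‖ξ b - ξ a‖ := by
    have : f b - f a = inner ℝ u (ξ b - ξ a) := by simp [hf, inner_sub_right]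
    rw [this, hu, real_inner_smul_left, real_inner_self_eq_norm_sq]
    have : ‖ξ b - ξ a‖ ≠ 0 := norm_ne_zero_iff.2 h0
    field_simp
  have hd := hξ.ae_differentiableWithinAt_of_mem_real
  have hb : ∀ᵐ t : ℝ, t ≠ b := by simp [ae_iff]
  have hle : ∀ᵐ t, t ∈ uIoc a b → ‖deriv f t‖ ≤ V := by
    filter_upwards [hd, hV, hb] with t h1 h2 h3 ht
    rw [uIoc_of_le hab] at ht
    have ht' : t ∈ Icc a b := Ioc_subset_Icc_self ht
    have hdt : DifferentiableAt ℝ ξ t :=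
      (h1 ht').differentiableAt (Icc_mem_nhds ht.1 (lt_of_le_of_ne ht.2 h3))
    have hdf : HasDerivAt f (innerSL ℝ u (deriv ξ t)) t :=
      (innerSL ℝ u).hasFDerivAt.comp_hasDerivAt t hdt.hasDerivAt
    rw [hdf.deriv]
    calc ‖innerSL ℝ u (deriv ξ t)‖ ≤ ‖u‖ * ‖deriv ξ t‖ := norm_inner_le_norm u _
      _ ≤ V := by rw [hu1, one_mul]; exact h2 ht'
  have := intervalIntegral.norm_integral_le_of_norm_le_const_ae hle
  rw [hint, hfab, norm_norm, abs_of_nonneg (sub_nonneg.2 hab)] at this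
  exact this

/-- The marked lines that meet the closed ball of radius `R` about the origin, and whose
speed-limit is at least `V`. -/
def fastLines (d : ℕ) (R V : ℝ) : Set (Line d × ℝ) :=
  hittingSet (Metric.closedBall 0 R) ×ˢ Ici V

theorem measurableSet_hittingSet {d : ℕ} {K : Set (E d)} (hK : IsCompact K) :
    MeasurableSet (hittingSet K) :=
  MeasurableSpace.measurableSet_generateFrom ⟨K, hK, rfl⟩

theorem measurableSet_fastLines (d : ℕ) (R V : ℝ) : MeasurableSet (fastLines d R V) :=
  (measurableSet_hittingSet (isCompact_closedBall 0 R)).prod measurableSet_Ici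

theorem IsPiPath.continuousOn {d : ℕ} {π : Set (Line d × ℝ)} {τ : EReal} {ξ : ℝ → E d}
    (h : IsPiPath π τ ξ) : ContinuousOn ξ (timeInterval τ) :=
  h.locallyLipschitz.continuousOn

/-- A path inside a ball that is hit by no line of speed-limit `V` or more moves at speed at most
`V`. -/
theorem IsPiPath.norm_sub_le {d : ℕ} {π : Set (Line d × ℝ)} {τ : EReal} {ξ : ℝ → E d}
    (h : IsPiPath π τ ξ) {R V : ℝ} (hV : 0 < V) (hπ : π ∩ fastLines d R V = ∅) {a b : ℝ}
    (ha : 0 ≤ a) (hab : a ≤ b) (hb : (b : EReal) < τ)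
    (hR : ∀ s ∈ Icc a b, ξ s ∈ Metric.closedBall 0 R) : ‖ξ b - ξ a‖ ≤ V * (b - a) := by
  have hsub := timeInterval_subset_of_le ha hb
  obtain ⟨K, hK⟩ := (h.locallyLipschitz.mono hsub).exists_lipschitzOnWith_of_compact isCompact_Icc
  refine norm_sub_le_of_ae_norm_deriv_le hab hK ?_
  have h0 := h.speed_limit V hV
  rw [measure_eq_zero_iff_ae_notMem] at h0
  filter_upwards [h0] with t ht htab
  by_contra! hlt
  refine ht ⟨hsub htab, hlt, ?_⟩
  rintro ⟨ℓ, w, hw, hvw, hx⟩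
  exact (eq_empty_iff_forall_notMem.1 hπ) (ℓ, w) ⟨hw, ⟨⟨_, hx, hR t htab⟩, hvw⟩⟩

/-- A path that starts at distance at most `2 ^ n` from the origin for all `n ∈ s` needs at least
the time `1 / (2 * K)` to pass from distance `2 ^ n` to distance `2 ^ (n + 1)`, if no line of
speed-limit `K * 2 ^ (n + 1)` or more meets the ball of radius `2 ^ (n + 1)`. -/
theorem IsPiPath.card_le {d : ℕ} {π : Set (Line d × ℝ)} {τ : EReal} {ξ : ℝ → E d}
    (h : IsPiPath π τ ξ) {K : ℝ} (hK : 0 < K) (s : Finset ℕ)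
    (hs : ∀ n ∈ s, ‖ξ 0‖ ≤ 2 ^ n ∧ π ∩ fastLines d (2 ^ (n + 1)) (K * 2 ^ (n + 1)) = ∅) :
    ∀ t : ℝ, 0 ≤ t → (t : EReal) < τ → (∀ n ∈ s, (2 : ℝ) ^ (n + 1) ≤ ‖ξ t‖) →
      (s.card : ℝ) ≤ 2 * K * t := by
  induction s using Finset.induction_on_max with
  | empty => intro t ht _ _; simp; positivity
  | insert m s hm ih =>
    intro t ht htτ hfar
    have hc : ContinuousOn (fun r => ‖ξ r‖) (Icc 0 t) :=
      (h.continuousOn.mono (timeInterval_subset_of_le le_rfl htτ)).norm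
    obtain ⟨h0m, hπ⟩ := hs m (Finset.mem_insert_self m s)
    have hcomp : IsCompact (Icc 0 t ∩ (fun r => ‖ξ r‖) ⁻¹' Ici (2 ^ (m + 1))) :=
      isCompact_Icc.of_isClosed_subset (hc.preimage_isClosed_of_isClosed isClosed_Icc isClosed_Ici)
        inter_subset_left
    -- `b` is the first time at distance `2 ^ (m + 1)` or more, so the path stays in the slow ball
    -- up to `b`.
    obtain ⟨b, ⟨hb, hbm⟩, hleast⟩ := hcomp.exists_isLeast
      ⟨t, right_mem_Icc.2 ht, hfar m (Finset.mem_insert_self m s)⟩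
    have hbτ : (b : EReal) < τ := lt_of_le_of_lt (EReal.coe_le_coe_iff.2 hb.2) htτ
    have hcb := hc.mono (Icc_subset_Icc_right hb.2)
    have hbelow : ∀ r ∈ Icc 0 b, ‖ξ r‖ ≤ 2 ^ (m + 1) := by
      intro r hr
      by_contra! hlt
      obtain ⟨q, hq, hqm⟩ := intermediate_value_Icc hr.1 (hcb.mono (Icc_subset_Icc_right hr.2))
        (show (2 : ℝ) ^ (m + 1) ∈ Icc ‖ξ 0‖ ‖ξ r‖ from
          ⟨h0m.trans (pow_le_pow_right₀ one_le_two (Nat.le_succ m)), hlt.le⟩)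
      have hbq : b ≤ q := hleast ⟨⟨hq.1, hq.2.trans (hr.2.trans hb.2)⟩, hqm.ge⟩
      have hqr : q = r := le_antisymm hq.2 (hr.2.trans hbq)
      rw [hqr] at hqm
      exact hlt.ne' hqm
    have hstep : (2 : ℝ) ^ m ≤ 2 ^ (m + 1) := pow_le_pow_right₀ one_le_two (Nat.le_succ m)
    obtain ⟨a, ha, ham⟩ := intermediate_value_Icc hb.1 hcb
      (show (2 : ℝ) ^ m ∈ Icc ‖ξ 0‖ ‖ξ b‖ from ⟨h0m, hstep.trans hbm⟩)
    simp only at ham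
    have haτ : (a : EReal) < τ := lt_of_le_of_lt (EReal.coe_le_coe_iff.2 ha.2) hbτ
    -- At time `a` the path is at distance `2 ^ m`, so all smaller scales of `s` have already been
    -- crossed.
    have h1 : (s.card : ℝ) ≤ 2 * K * a := by
      refine ih (fun n hn => hs n (Finset.mem_insert_of_mem hn)) a ha.1 haτ fun n hn => ?_
      rw [ham]
      exact pow_le_pow_right₀ one_le_two (hm n hn)
    have h2 := h.norm_sub_le (by positivity) hπ ha.1 ha.2 hbτ fun r hr =>
      mem_closedBall_zero_iff.2 (hbelow r ⟨ha.1.trans hr.1, hr.2⟩)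
    have h3 : (2 : ℝ) ^ m ≤ K * 2 ^ (m + 1) * (b - a) := by
      refine le_trans ?_ h2
      have := norm_sub_norm_le (ξ b) (ξ a)
      have hbm' : (2 : ℝ) ^ (m + 1) ≤ ‖ξ b‖ := hbm
      rw [ham] at this
      rw [pow_succ] at hbm'
      linarith
    have h4 : 1 ≤ 2 * K * (b - a) := by
      have hp : (0 : ℝ) < 2 ^ m := by positivity
      rw [pow_succ] at h3
      refine le_of_mul_le_mul_left ?_ hp
      linarith
    have hnot : m ∉ s := fun hms => (hm m hms).false
    rw [Finset.card_insert_of_notMem hnot]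
    push_cast
    nlinarith [hb.2]

end SpeedLimits

/-! ### Scaling of the intensity measure -/

namespace SpeedLimits

theorem setOf_lineThrough_mem_hittingSet_smul {d : ℕ} (u : UnitSphere d) {r : ℝ} (hr : 0 < r) :
    {y : E d | inner ℝ (u : E d) y = 0 ∧ lineThrough u y ∈ hittingSet (Metric.closedBall 0 r)} =
      r • {y : E d | inner ℝ (u : E d) y = 0 ∧
        lineThrough u y ∈ hittingSet (Metric.closedBall 0 1)} := by
  ext y
  rw [mem_smul_set_iff_inv_smul_mem₀ hr.ne']
  simp only [mem_ofPred_eq, inner_smul_right, mul_eq_zero, inv_eq_zero, hr.ne', false_or]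
  refine and_congr_right fun _ => ⟨?_, ?_⟩
  · rintro ⟨z, hz, hzr⟩
    obtain ⟨s, rfl⟩ := (mem_lineThrough u y z).1 hz
    refine ⟨r⁻¹ • (y + s • (u : E d)), (mem_lineThrough _ _ _).2 ⟨r⁻¹ * s, ?_⟩, ?_⟩
    · rw [smul_add, smul_smul]
    · rw [mem_closedBall_zero_iff] at hzr ⊢
      rw [norm_smul, norm_inv, Real.norm_of_nonneg hr.le, inv_mul_le_one₀ hr]
      exact hzr
  · rintro ⟨z, hz, hzr⟩
    obtain ⟨s, rfl⟩ := (mem_lineThrough u _ z).1 hz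
    refine ⟨r • (r⁻¹ • y + s • (u : E d)), (mem_lineThrough _ _ _).2 ⟨r * s, ?_⟩, ?_⟩
    · rw [smul_add, smul_smul, smul_smul, mul_inv_cancel₀ hr.ne', one_smul]
    · rw [mem_closedBall_zero_iff] at hzr ⊢
      rw [norm_smul, Real.norm_of_nonneg hr.le]
      exact mul_le_of_le_one_right hr.le hzr

/-- For each direction the shadow of the ball scales by `r`, and `(d - 1)`-dimensional Hausdorff
measure is homogeneous of degree `d - 1`. -/
theorem lineMeasure_hittingSet_closedBall (d : ℕ) {r : ℝ} (hr : 0 < r) :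
    lineMeasure d (hittingSet (Metric.closedBall 0 r)) =
      ENNReal.ofReal r ^ (d - 1) * lineMeasure d (hittingSet (Metric.closedBall 0 1)) := by
  rw [lineMeasure_apply (measurableSet_hittingSet (isCompact_closedBall 0 r)),
    lineMeasure_apply (measurableSet_hittingSet (isCompact_closedBall 0 1)), mul_left_comm]
  congr 1
  rw [← lintegral_const_mul' _ _ (ENNReal.pow_ne_top ENNReal.ofReal_ne_top)]
  refine lintegral_congr fun u => ?_
  rw [setOf_lineThrough_mem_hittingSet_smul u hr, Measure.euclideanHausdorffMeasure_smul₀ _ hr.ne',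
    ENNReal.smul_def, smul_eq_mul, ENNReal.coe_pow]
  congr 2
  rw [ENNReal.ofReal, Real.toNNReal_of_nonneg hr.le]
  congr 1
  ext
  simp [abs_of_pos hr]

theorem lineMeasure_hittingSet_closedBall_ne_top (d : ℕ) :
    lineMeasure d (hittingSet (Metric.closedBall 0 1)) ≠ ∞ := by
  have hA := measurableSet_hittingSet (isCompact_closedBall (0 : E d) 1)
  rw [lineMeasure_apply hA]
  refine ENNReal.mul_ne_top ?_ ?_
  · refine ENNReal.inv_ne_top.2 (mul_ne_zero two_ne_zero ?_)
    exact (Metric.measure_ball_pos volume _ one_pos).ne'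
  -- In the slab form, a point `x` of the slab lies within `2` along `u` of a point of the unit
  -- ball, hence the radius `3`.
  have hle : ∀ u : UnitSphere d, μHE[d - 1] {y : E d | inner ℝ (u : E d) y = 0 ∧
      lineThrough u y ∈ hittingSet (Metric.closedBall 0 1)} ≤
        volume (Metric.closedBall (0 : E d) 3) := by
    intro u
    rw [← parallelLineMeasure_apply u hA, parallelLineMeasure_eq_slab u hA]
    refine measure_mono ?_
    rintro x ⟨⟨hx0, hx1⟩, z, hz, hz1⟩
    obtain ⟨s, rfl⟩ := (mem_lineThrough u x z).1 hz
    have hu : ‖(u : E d)‖ = 1 := norm_eq_of_mem_sphere u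
    rw [mem_closedBall_zero_iff] at hz1 ⊢
    have h1 : |inner ℝ (u : E d) x + s| ≤ 1 := by
      have h2 := abs_real_inner_le_norm (u : E d) (x + s • (u : E d))
      rw [inner_add_right, inner_smul_right, real_inner_self_eq_norm_sq, hu] at h2
      simpa using h2.trans (by simpa using hz1)
    have h2 : |s| ≤ 2 := by
      rw [abs_le] at h1 ⊢
      constructor <;> linarith
    calc ‖x‖ = ‖(x + s • (u : E d)) - s • (u : E d)‖ := by rw [add_sub_cancel_right]
      _ ≤ ‖x + s • (u : E d)‖ + ‖s • (u : E d)‖ := norm_sub_le _ _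
      _ ≤ 1 + 2 := by
          refine add_le_add hz1 ?_
          rwa [norm_smul, hu, mul_one]
      _ = 3 := by norm_num
  refine ne_top_of_le_ne_top ?_ (lintegral_mono hle)
  rw [lintegral_const]
  exact ENNReal.mul_ne_top measure_closedBall_lt_top.ne (measure_ne_top _ _)

theorem speedMeasure_Ici {γ : ℝ} (hγ : 1 < γ) {v : ℝ} (hv : 0 < v) :
    speedMeasure γ (Ici v) = ENNReal.ofReal (v ^ (1 - γ)) := by
  have hsub : Ioi v ⊆ Ioi (0 : ℝ) := Ioi_subset_Ioi hv.le
  rw [speedMeasure, withDensity_apply _ measurableSet_Ici, Measure.restrict_restrict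
    measurableSet_Ici, inter_eq_left.2 (Ici_subset_Ioi.2 hv), ← setLIntegral_congr Ioi_ae_eq_Ici,
    ← ofReal_integral_eq_lintegral_ofReal]
  · congr 1
    rw [integral_const_mul, integral_Ioi_rpow_of_lt (by linarith) hv]
    have : 1 - γ ≠ 0 := by linarith
    rw [show -γ + 1 = 1 - γ by ring]
    field_simp
    ring
  · exact (integrableOn_Ioi_rpow_of_lt (by linarith) hv).const_mul _
  · refine (ae_restrict_iff' measurableSet_Ioi).2 (ae_of_all _ fun x hx => ?_)
    exact mul_nonneg (by linarith) (Real.rpow_nonneg (hsub hx).le _)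

/-- Scale-invariant bound for the rate of lines with speed-limit at least `K * R` that meet the
ball of radius `R ≥ 1`. -/
theorem markedLineIntensity_fastLines_le {d : ℕ} (hd : 2 ≤ d) {γ : ℝ} (hγ : (d : ℝ) ≤ γ) {K R : ℝ}
    (hK : 1 ≤ K) (hR : 1 ≤ R) :
    markedLineIntensity d γ (fastLines d R (K * R)) ≤
      lineMeasure d (hittingSet (Metric.closedBall 0 1)) * ENNReal.ofReal K⁻¹ := by
  have hd' : (2 : ℝ) ≤ d := by exact_mod_cast hd
  have hR0 : 0 < R := by linarith
  have hK0 : 0 < K := by linarith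
  have : SFinite (speedMeasure γ) := by unfold speedMeasure; infer_instance
  rw [markedLineIntensity, fastLines, Measure.prod_prod, lineMeasure_hittingSet_closedBall d hR0,
    speedMeasure_Ici (by linarith) (by positivity), mul_right_comm, mul_comm]
  gcongr
  rw [← ENNReal.ofReal_pow hR0.le, ← ENNReal.ofReal_mul (by positivity)]
  refine ENNReal.ofReal_le_ofReal ?_
  rw [Real.mul_rpow hK0.le hR0.le, ← Real.rpow_natCast, Nat.cast_sub (by omega), mul_left_comm,
    ← Real.rpow_add hR0, ← Real.rpow_neg_one]
  -- The exponent of `R` is `d - γ ≤ 0`, and `1 - γ ≤ -1` because `γ ≥ d ≥ 2`.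
  calc K ^ (1 - γ) * R ^ ((d : ℝ) - (1 : ℕ) + (1 - γ)) ≤ K ^ (-1 : ℝ) * 1 := by
        gcongr
        · linarith
        · refine Real.rpow_le_one_of_one_le_of_nonpos hR ?_
          push_cast; linarith
    _ = K ^ (-1 : ℝ) := mul_one _

end SpeedLimits

/-! ### Almost sure existence and measurability of barriers -/

namespace SpeedLimits

theorem measurableSet_inter_eq_empty {X : Type*} [MeasurableSpace X] {A : Set X}
    (hA : MeasurableSet A) : MeasurableSet[configurationSigma X] {π : Set X | π ∩ A = ∅} := by
  have hle : MeasurableSpace.comap (fun π : Set X => (π ∩ A).encard) ⊤ ≤ configurationSigma X :=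
    le_iSup₂_of_le A hA le_rfl
  refine hle _ ⟨{0}, trivial, ?_⟩
  ext π
  simp [encard_eq_zero]

/-- A Poisson process charges `A` with probability at most the intensity of `A`. -/
theorem IsPoissonProcess.measure_inter_ne_empty_le {Ω X : Type*} [MeasurableSpace Ω]
    [MeasurableSpace X] {P : Measure Ω} [IsProbabilityMeasure P] {Φ : Ω → Set X} {ν : Measure X}
    (h : IsPoissonProcess P Φ ν) {A : Set X} (hA : MeasurableSet A) :
    P {ω | Φ ω ∩ A ≠ ∅} ≤ ν A := by
  rcases eq_or_ne (ν A) ∞ with hν | hν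
  · rw [hν]; exact le_top
  have hm : MeasurableSet {ω | Φ ω ∩ A = ∅} := h.measurable (measurableSet_inter_eq_empty hA)
  have hcount : Measurable fun ω => (Φ ω ∩ A).encard := by
    have hle : MeasurableSpace.comap (fun π : Set X => (π ∩ A).encard) ⊤ ≤ configurationSigma X :=
      le_iSup₂_of_le A hA le_rfl
    exact fun B hB => h.measurable (hle _ ⟨B, trivial, rfl⟩)
  have hempty : P {ω | Φ ω ∩ A = ∅} = ENNReal.ofReal (Real.exp (-(ν A).toReal)) := by
    have h1 := congrArg (fun μ : Measure ℕ∞ => μ {0}) (h.law A hA hν)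
    beta_reduce at h1
    rw [Measure.map_apply hcount (measurableSet_singleton _),
      Measure.map_apply (measurable_of_countable _) (measurableSet_singleton _)] at h1
    have h2 : (fun n : ℕ => (n : ℕ∞)) ⁻¹' {0} = {0} := by ext n; simp
    have h3 : (fun ω => (Φ ω ∩ A).encard) ⁻¹' {0} = {ω | Φ ω ∩ A = ∅} := by
      ext ω; simp [encard_eq_zero]
    rw [h2, h3, poissonMeasure_singleton] at h1
    simpa [ENNReal.coe_toNNReal_eq_toReal] using h1
  have hcompl : {ω | Φ ω ∩ A ≠ ∅} = {ω | Φ ω ∩ A = ∅}ᶜ := rfl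
  rw [hcompl, prob_compl_eq_one_sub hm, hempty, tsub_le_iff_right, ← ENNReal.ofReal_toReal hν,
    ENNReal.toReal_ofReal ENNReal.toReal_nonneg,
    ← ENNReal.ofReal_add ENNReal.toReal_nonneg (Real.exp_nonneg _), ENNReal.one_le_ofReal]
  -- The void probability is `exp (-ν A)`, and `1 - exp (-x) ≤ x`.
  have := Real.add_one_le_exp (-(ν A).toReal)
  linarith

/-- No line of speed-limit `(K + 1) * 2 ^ (n + 1)` or more meets the ball of radius
`2 ^ (n + 1)`. -/
def IsSlowScale {d : ℕ} (π : Set (Line d × ℝ)) (K n : ℕ) : Prop :=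
  π ∩ fastLines d (2 ^ (n + 1)) ((K + 1) * 2 ^ (n + 1)) = ∅

theorem ae_exists_frequently_isSlowScale {d : ℕ} (hd : 2 ≤ d) {γ : ℝ} (hγ : (d : ℝ) ≤ γ)
    {Ω : Type*} [MeasurableSpace Ω] {P : Measure Ω} [IsProbabilityMeasure P]
    {Φ : Ω → Set (Line d × ℝ)} (hΦ : IsPoissonProcess P Φ (markedLineIntensity d γ)) :
    ∀ᵐ ω ∂P, ∃ K : ℕ, ∃ᶠ n in Filter.atTop, IsSlowScale (Φ ω) K n := by
  set c := lineMeasure d (hittingSet (Metric.closedBall 0 1))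
  have hslow : ∀ K n : ℕ, P {ω | ¬ IsSlowScale (Φ ω) K n} ≤ c * ENNReal.ofReal ((K : ℝ) + 1)⁻¹ :=
    fun K n => (hΦ.measure_inter_ne_empty_le (measurableSet_fastLines d _ _)).trans
      (markedLineIntensity_fastLines_le hd hγ (by simp) (one_le_pow₀ one_le_two))
  have hK : ∀ K : ℕ, P {ω | ∀ᶠ n in Filter.atTop, ¬ IsSlowScale (Φ ω) K n} ≤
      c * ENNReal.ofReal ((K : ℝ) + 1)⁻¹ := by
    intro K
    have hU : {ω | ∀ᶠ n in Filter.atTop, ¬ IsSlowScale (Φ ω) K n} =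
        ⋃ N : ℕ, {ω | ∀ n ≥ N, ¬ IsSlowScale (Φ ω) K n} := by
      ext ω; simp [Filter.eventually_atTop]
    -- The union is increasing, and its `N`-th event lies in the failure of the single scale `N`; so
    -- the bound passes to the limit.
    have hmono : Monotone fun N : ℕ => {ω | ∀ n ≥ N, ¬ IsSlowScale (Φ ω) K n} :=
      fun N M hNM ω hω n hn => hω n (le_trans hNM hn)
    rw [hU, hmono.measure_iUnion]
    refine iSup_le fun N => (measure_mono ?_).trans (hslow K N)
    exact fun ω hω => hω N le_rfl
  rw [ae_iff]
  have hlim : Filter.Tendsto (fun K : ℕ => c * ENNReal.ofReal ((K : ℝ) + 1)⁻¹) Filter.atTop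
      (nhds (c * ENNReal.ofReal 0)) := by
    refine ENNReal.Tendsto.const_mul (ENNReal.tendsto_ofReal ?_)
      (Or.inr (lineMeasure_hittingSet_closedBall_ne_top d))
    simpa [one_div] using tendsto_one_div_add_atTop_nhds_zero_nat (𝕜 := ℝ)
  rw [ENNReal.ofReal_zero, mul_zero] at hlim
  refine le_antisymm (ge_of_tendsto' hlim fun K => (measure_mono fun ω hω => ?_).trans (hK K))
    zero_le
  simp only [mem_ofPred_eq, not_exists, Filter.not_frequently] at hω
  exact hω K

/-- There are enough slow scales between `r₀` and `2 ^ m` to delay every path until time `T`. -/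
def IsBarrier {d : ℕ} (T r₀ : ℝ) (π : Set (Line d × ℝ)) (m : ℕ) : Prop :=
  ∃ K : ℕ, ∃ s ∈ (Finset.range m).powerset, 2 * ((K : ℝ) + 1) * T ≤ s.card ∧
    ∀ n ∈ s, r₀ ≤ 2 ^ n ∧ IsSlowScale π K n

/-- Only countably many `K` and finitely many `s` occur, and slowness of a scale is a void event. -/
theorem measurableSet_isBarrier (d : ℕ) (T r₀ : ℝ) (m : ℕ) :
    MeasurableSet[configurationSigma (Line d × ℝ)] {π | IsBarrier T r₀ π m} := by
  have hU : {π : Set (Line d × ℝ) | IsBarrier T r₀ π m} =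
      ⋃ K : ℕ, ⋃ s ∈ (Finset.range m).powerset, {π | 2 * ((K : ℝ) + 1) * T ≤ s.card} ∩
        ⋂ n ∈ s, ({π | r₀ ≤ 2 ^ n} ∩ {π | IsSlowScale π K n}) := by
    ext π; simp [IsBarrier, and_left_comm]
  rw [hU]
  let _ := configurationSigma (Line d × ℝ)
  exact .iUnion fun K => Finset.measurableSet_biUnion _ fun s _ =>
    (MeasurableSet.const _).inter <| Finset.measurableSet_biInter _ fun n _ =>
      (MeasurableSet.const _).inter (measurableSet_inter_eq_empty (measurableSet_fastLines d _ _))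

theorem IsBarrier.norm_le {d : ℕ} {T r₀ : ℝ} {π : Set (Line d × ℝ)} {m : ℕ}
    (hm : IsBarrier T r₀ π m) {τ : EReal} {ξ : ℝ → E d} (h : IsPiPath π τ ξ) (h0 : ‖ξ 0‖ ≤ r₀)
    {t : ℝ} (ht : 0 ≤ t) (htτ : (t : EReal) < τ) (htT : t < T) : ‖ξ t‖ ≤ 2 ^ m := by
  obtain ⟨K, s, hsm, hcard, hs⟩ := hm
  by_contra! hfar
  have hK : (0 : ℝ) < K + 1 := by positivity
  have := h.card_le hK s (fun n hn => ⟨h0.trans (hs n hn).1, (hs n hn).2⟩) t ht htτ fun n hn =>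
    (pow_le_pow_right₀ one_le_two
      (Nat.succ_le_of_lt (Finset.mem_range.1 (Finset.mem_powerset.1 hsm hn)))).trans hfar.le
  -- Having crossed every scale of `s` gives `2 * (K + 1) * T ≤ s.card ≤ 2 * (K + 1) * t`, against
  -- `t < T`.
  nlinarith

theorem exists_isBarrier {d : ℕ} {π : Set (Line d × ℝ)} {K : ℕ}
    (h : ∃ᶠ n in Filter.atTop, IsSlowScale π K n) (T r₀ : ℝ) : ∃ m, IsBarrier T r₀ π m := by
  have hr : ∀ᶠ n : ℕ in Filter.atTop, r₀ ≤ 2 ^ n :=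
    (tendsto_pow_atTop_atTop_of_one_lt one_lt_two).eventually_ge_atTop r₀
  have hinf := Nat.frequently_atTop_iff_infinite.1 (h.and_eventually hr)
  obtain ⟨s, hs, hcard⟩ := hinf.exists_subset_card_eq ⌈2 * ((K : ℝ) + 1) * T⌉₊
  refine ⟨s.sup id + 1, K, s, Finset.mem_powerset.2 fun n hn => ?_, ?_, fun n hn => ?_⟩
  · exact Finset.mem_range.2 (Nat.lt_succ_of_le (Finset.le_sup (f := id) hn))
  · rw [hcard]; exact Nat.le_ceil _
  · exact (hs hn).symm

end SpeedLimits

theorem mainTheorem7 (d : ℕ) (hd : 2 ≤ d) (γ : ℝ) (hγ : (d : ℝ) ≤ γ)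
    (T : ℝ) (hT : 0 < T) (r₀ : ℝ) (hr₀ : 0 < r₀) :
    ∃ C : Set (SpeedLimits.Line d × ℝ) → ℝ,
      Measurable[SpeedLimits.configurationSigma (SpeedLimits.Line d × ℝ)] C ∧
      ∀ (Ω : Type*) [MeasurableSpace Ω] (P : Measure Ω) [IsProbabilityMeasure P]
        (Φ : Ω → Set (SpeedLimits.Line d × ℝ)),
        SpeedLimits.IsPoissonProcess P Φ (SpeedLimits.markedLineIntensity d γ) →
        ∀ᵐ ω ∂P, ∀ (τ : EReal) (ξ : ℝ → SpeedLimits.E d),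
          SpeedLimits.IsPiPath (Φ ω) τ ξ → ξ 0 ∈ Metric.closedBall (0 : SpeedLimits.E d) r₀ →
          ∀ t : ℝ, 0 ≤ t → (t : EReal) < τ → t < T → ‖ξ t‖ ≤ C (Φ ω) := by
  classical
  let _ := SpeedLimits.configurationSigma (SpeedLimits.Line d × ℝ)
  have hbarrier := SpeedLimits.measurableSet_isBarrier d T r₀
  -- The second alternative makes the search for the least `m` total and measurable; it yields `m =
  -- 0` on configurations without a barrier, which almost surely do not occur.
  have hex : ∀ π : Set (SpeedLimits.Line d × ℝ), ∃ m,
      SpeedLimits.IsBarrier T r₀ π m ∨ ∀ j, ¬ SpeedLimits.IsBarrier T r₀ π j := by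
    intro π
    by_cases h : ∃ m, SpeedLimits.IsBarrier T r₀ π m
    · exact h.imp fun _ => Or.inl
    · exact ⟨0, Or.inr (not_exists.1 h)⟩
  refine ⟨fun π => 2 ^ Nat.find (hex π), ?_, ?_⟩
  · refine (measurable_from_nat (f := fun m => (2 : ℝ) ^ m)).comp (measurable_find hex fun m => ?_)
    have hnone : {π | ∀ j, ¬ SpeedLimits.IsBarrier T r₀ π j} =
        ⋂ j, {π : Set (SpeedLimits.Line d × ℝ) | SpeedLimits.IsBarrier T r₀ π j}ᶜ := by
      ext π; simp
    refine (hbarrier m).union (MeasurableSet.congr ?_ hnone.symm)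
    exact .iInter fun j => (hbarrier j).compl
  · intro Ω _ P _ Φ hΦ
    filter_upwards [SpeedLimits.ae_exists_frequently_isSlowScale hd hγ hΦ] with ω hω
    obtain ⟨K, hK⟩ := hω
    obtain ⟨m, hm⟩ := SpeedLimits.exists_isBarrier hK T r₀
    have hfind := (Nat.find_spec (hex (Φ ω))).resolve_right fun h => h m hm
    exact fun τ ξ hξ h0 t ht htτ htT =>
      hfind.norm_le hξ (mem_closedBall_zero_iff.1 h0) ht htτ htT
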